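/- Consider a discrete-time queue with two servers. For $j=1,2$ the environment $X_j(t)\in\{0,1\}$ of server $j$ is an autonomous Markov chain with transition matrix $P^{(j)}=\begin{pmatrix}1-p_j&p_j\\q_j&1-q_j\end{pmatrix}$, $p_j,q_j\in[0,1]$, and a service attempt at server $j$ in environment state $i$ succeeds with probability $\mu_i^{(j)}\in[0,1]$. In each slot one job arrives with probability $\lambda\in[0,1]$; write $\bar x=1-x$. All these random choices are independent. A finite-state controller with state $(\psi_1,\psi_2)\in\{1,\dots,M\}^2$, $M\ge 1$, is given by row-stochastic $M\times M$ matrices $N^{(j)},S^{(j)},F^{(j)}$ ($j=1,2$) and an $M\times M$ matrix $C$ with entries in $[0,1]$: if the queue is non-empty, server 2 is selected with probability $C_{\psi_1,\psi_2}$ and server 1 otherwise; if the queue is empty, no server is selected. Then $\psi_j$ moves according to row $\psi_j$ of $N^{(j)}$ if server $j$ was not selected, of $S^{(j)}$ if it was selected and the service succeeded, and of $F^{(j)}$ if it was selected and the service failed. The queue evolves by $Q(t+1)=Q(t)+E(t)-I(t)$, where $E(t)$ and $I(t)$ indicate an arrival and a service success in slot $t$. Let $Z(t)=\big(Q(t),((X_1(t),X_2(t)),(\psi_1(t),\psi_2(t)))\big)$,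 with level $Q(t)$ and phase the remaining components. For environment states $k,\ell\in\{0,1\}$ put, with $D_2=\mathrm{diag}(\mathrm{vec}(C'))$ and $D_1=\mathrm{diag}(\mathrm{vec}(\bar C'))$, $$\tilde S_{k\ell}=\mu^{(2)}_\ell D_2(N^{(1)}\otimes S^{(2)})+\mu^{(1)}_kD_1(S^{(1)}\otimes N^{(2)}),\qquad \tilde F_{k\ell}=\bar\mu^{(2)}_\ell D_2(N^{(1)}\otimes F^{(2)})+\bar\mu^{(1)}_kD_1(F^{(1)}\otimes N^{(2)}),\qquad \tilde N_{k\ell}=N^{(1)}\otimes N^{(2)},$$ and let $\tilde S$ (likewise $\tilde F,\tilde N$) be the $4M^2\times4M^2$ matrix whose $((k,\ell),(k',\ell'))$ block is $P^{(1)}_{kk'}P^{(2)}_{\ell\ell'}\tilde S_{k\ell}$. Then: 1. $\tilde S+\tilde F$ and $\tilde N$ are stochastic, and for every $\lambda\in[0,1]$ the one-step transition probabilities of $Z(t)$ form the QBD matrix with blocks $A_{-1}=\bar\lambda\tilde S$, $A_0=\bar\lambda\tilde F+\lambda\tilde S$, $A_1=\lambda\tilde F$ (one level down, same level, one level up) in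 levels $n\ge1$, and boundary blocks $\tilde A_0=\bar\lambda\tilde N$, $\tilde A_1=\lambda\tilde N$ in level $0$. 2. For every $\lambda\in[0,1]$, the stationary distributions of $A_{-1}+A_0+A_1$ are exactly those of $\tilde S+\tilde F$, which does not depend on $\lambda$. At least one exists, and it is unique if $\tilde S+\tilde F$ is irreducible. 3. Let $\pi_\infty$ be a stationary distribution of $\tilde S+\tilde F$ and $\mu^*=\pi_\infty\tilde S\mathbf 1$, which does not depend on $\lambda$. For every $\lambda\in[0,1]$, $$\pi_\infty(A_1-A_{-1})\mathbf 1<0\iff\lambda<\mu^*.$$ If moreover $\pi_\infty$ is the only stationary distribution of $\tilde S+\tilde F$, then $\lambda<\mu^*$ implies that $Z(t)$ is stable: from every initial state the expected first time $t\ge1$ with $Q(t)=0$ is finite, and every essential state $z$ (one that can be reached back from every state accessible from $z$; these are all states if $Z(t)$ is irreducible) is positive recurrent, i.e. has finite mean return time. -/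

import Mathlib

open Matrix MeasureTheory
open scoped ENNReal Kronecker

noncomputable section

/-! ### Discrete time Markov chains on a countable state space -/

/-- The probability mass function of a (real) probability vector. -/
def pmfOfVector {α : Type*} [Fintype α] (f : α → ℝ) (hf : f ∈ stdSimplex ℝ α) : PMF α :=
  PMF.ofFintype (fun a => ENNReal.ofReal (f a)) (by
    rw [← ENNReal.ofReal_sum_of_nonneg (fun a _ => hf.1 a), hf.2, ENNReal.ofReal_one])

/-- A Bernoulli variable with success probability `p`. -/
def coin (p : ℝ) (hp : p ∈ Set.Icc (0 : ℝ) 1) : PMF Bool :=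
  pmfOfVector (fun b => if b then p else 1 - p)
    ⟨fun b => by cases b <;> simp [hp.1, hp.2], by simp⟩

section Chain

variable {S : Type} [MeasurableSpace S] [Countable S] [MeasurableSingletonClass S]

/-- The transition law `K`, as a Markov kernel depending only on the last state of a trajectory
up to time `n`. -/
def stepKernel (K : S → PMF S) (n : ℕ) :
    ProbabilityTheory.Kernel ((i : Finset.Iic n) → S) S :=
  (ProbabilityTheory.Kernel.ofFunOfCountable (fun s => (K s).toMeasure)).comap
    (fun h : (i : Finset.Iic n) → S => h ⟨n, Finset.mem_Iic.2 le_rfl⟩) (measurable_pi_apply _)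

instance stepKernel_isMarkovKernel (K : S → PMF S) (n : ℕ) :
    ProbabilityTheory.IsMarkovKernel (stepKernel K n) :=
  ⟨fun h => PMF.toMeasure.isProbabilityMeasure (K (h ⟨n, Finset.mem_Iic.2 le_rfl⟩))⟩

/-- The law, on the space of trajectories `ℕ → S`, of the Markov chain with one-step transition
law `K` started at `z` (Ionescu-Tulcea). -/
def chainLaw (K : S → PMF S) (z : S) : Measure (ℕ → S) :=
  ProbabilityTheory.Kernel.traj (X := fun _ : ℕ => S) (stepKernel K) 0 (fun _ => z)

/-- The first time `n ≥ 1` at which the trajectory `x` is in `B` (`∞` if there is none). -/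
def returnTime (B : Set S) (x : ℕ → S) : ℝ≥0∞ :=
  ⨅ n : {n : ℕ // 1 ≤ n ∧ x n ∈ B}, ((n : ℕ) : ℝ≥0∞)

/-- The expected first time `n ≥ 1` at which the chain started at `z` is in `B`. -/
def meanReturnTime (K : S → PMF S) (B : Set S) (z : S) : ℝ≥0∞ :=
  ∫⁻ x, returnTime B x ∂(chainLaw K z)

/-- The state `z` is positive recurrent: its mean return time is finite. -/
def IsPositiveRecurrent (K : S → PMF S) (z : S) : Prop :=
  meanReturnTime K {z} z < ∞

end Chain

/-- `w` can be reached from `z` with positive probability in some number of steps. -/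
def Accessible {S : Type} (K : S → PMF S) (z w : S) : Prop :=
  Relation.ReflTransGen (fun a b => K a b ≠ 0) z w

/-- `z` is essential: it can be reached back from every state accessible from it.
All states of an irreducible chain are essential, and inessential states are transient. -/
def IsEssential {S : Type} (K : S → PMF S) (z : S) : Prop :=
  ∀ w, Accessible K z w → Accessible K w z

/-- `π` is a stationary distribution of the finite stochastic matrix `P`. -/
def IsStationaryDistribution {ι : Type} [Fintype ι] (P : Matrix ι ι ℝ) (π : ι → ℝ) : Prop :=
  π ∈ stdSimplex ℝ ι ∧ π ᵥ* P = π

/-- The operation `P ⊛ diag(B₁, …, Bₙ)`: the `(a, b)` block is `P a b • B a`. -/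
def blockScale {e φ : Type} (P : Matrix e e ℝ) (B : e → Matrix φ φ ℝ) :
    Matrix (e × φ) (e × φ) ℝ :=
  Matrix.of fun x y => P x.1 y.1 * B x.1 x.2 y.2

/-- The infinite level-structured matrix with boundary blocks `B₀, B₁` in level `0` and blocks
`Am, A₀, Ap` (one level down, same level, one level up) in the levels `n ≥ 1`. -/
def qbdMatrix {φ : Type} (B₀ B₁ Am A₀ Ap : Matrix φ φ ℝ) : Matrix (ℕ × φ) (ℕ × φ) ℝ :=
  Matrix.of fun x y =>
    if x.1 = 0 then
      if y.1 = 0 then B₀ x.2 y.2 else if y.1 = 1 then B₁ x.2 y.2 else 0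
    else
      if y.1 + 1 = x.1 then Am x.2 y.2
      else if y.1 = x.1 then A₀ x.2 y.2
      else if y.1 = x.1 + 1 then Ap x.2 y.2
      else 0

/-! ### The two-server system with a finite state controller -/

/-- A server with a two-state Markov environment: the environment moves from `0` to `1` with
probability `p` and from `1` to `0` with probability `q`; in environment state `i` a service
attempt succeeds with probability `μ i`. -/
structure Server where
  p : ℝ
  q : ℝ
  μ : Fin 2 → ℝ
  p_mem : p ∈ Set.Icc (0 : ℝ) 1
  q_mem : q ∈ Set.Icc (0 : ℝ) 1
  μ_mem : ∀ i, μ i ∈ Set.Icc (0 : ℝ) 1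

/-- The transition matrix of the environment of a server. -/
def Server.P (s : Server) : Matrix (Fin 2) (Fin 2) ℝ :=
  !![1 - s.p, s.p; s.q, 1 - s.q]

lemma Server.P_row (s : Server) (i : Fin 2) : s.P i ∈ stdSimplex ℝ (Fin 2) := by
  have hp := s.p_mem
  have hq := s.q_mem
  refine ⟨fun j => ?_, ?_⟩
  · fin_cases i <;> fin_cases j <;> simp [Server.P, hp.1, hp.2, hq.1, hq.2]
  · fin_cases i <;> simp [Server.P, Fin.sum_univ_two]

/-- The stochastic matrices by which the controller updates its belief state about one server:
`N` if the server was not selected, `S` after a success and `F` after a failure. -/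
structure BeliefUpdate (M : ℕ) where
  N : Matrix (Fin M) (Fin M) ℝ
  S : Matrix (Fin M) (Fin M) ℝ
  F : Matrix (Fin M) (Fin M) ℝ
  N_mem : N ∈ rowStochastic ℝ (Fin M)
  S_mem : S ∈ rowStochastic ℝ (Fin M)
  F_mem : F ∈ rowStochastic ℝ (Fin M)

lemma row_mem_stdSimplex {M : ℕ} {A : Matrix (Fin M) (Fin M) ℝ}
    (hA : A ∈ rowStochastic ℝ (Fin M)) (i : Fin M) : A i ∈ stdSimplex ℝ (Fin M) := by
  refine ⟨fun j => hA.1 i j, ?_⟩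
  have h := congrFun hA.2 i
  simpa [Matrix.mulVec, dotProduct] using h

/-- The system and controller parameters, except for the arrival rate.  In controller state
`(i₁, i₂)` server 2 is selected with probability `C i₁ i₂`, and server 1 otherwise. -/
structure ControlledSystem (M : ℕ) where
  server₁ : Server
  server₂ : Server
  belief₁ : BeliefUpdate M
  belief₂ : BeliefUpdate M
  C : Matrix (Fin M) (Fin M) ℝ
  C_mem : ∀ i j, C i j ∈ Set.Icc (0 : ℝ) 1

/-- Environment states `(X₁, X₂)`. -/
abbrev Env : Type := Fin 2 × Fin 2

/-- Phases `((X₁, X₂), (ψ₁, ψ₂))`. -/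
abbrev Phase (M : ℕ) : Type := Env × (Fin M × Fin M)

/-- States `(Q, ((X₁, X₂), (ψ₁, ψ₂)))` of the chain `Z(t)`. -/
abbrev State (M : ℕ) : Type := ℕ × Phase M

namespace ControlledSystem

variable {M : ℕ} (sys : ControlledSystem M)

/-- The law of `Z(t+1)` given `Z(t) = z`, as prescribed by the dynamics of the system: there is an
arrival with probability `lam`; the environments move autonomously; if the queue is empty no server
is used; otherwise a server is selected at random through `C`, its service succeeds with the
probability given by its current environment state, and both belief states are updated. -/
def step (lam : ℝ) (hlam : lam ∈ Set.Icc (0 : ℝ) 1) (z : State M) : PMF (State M) :=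
  let Q : ℕ := z.1
  let X₁ : Fin 2 := z.2.1.1
  let X₂ : Fin 2 := z.2.1.2
  let ψ₁ : Fin M := z.2.2.1
  let ψ₂ : Fin M := z.2.2.2
  (coin lam hlam).bind fun E =>
  (pmfOfVector (sys.server₁.P X₁) (sys.server₁.P_row X₁)).bind fun X₁' =>
  (pmfOfVector (sys.server₂.P X₂) (sys.server₂.P_row X₂)).bind fun X₂' =>
  if Q = 0 then
    (pmfOfVector _ (row_mem_stdSimplex sys.belief₁.N_mem ψ₁)).bind fun ψ₁' =>
    (pmfOfVector _ (row_mem_stdSimplex sys.belief₂.N_mem ψ₂)).bind fun ψ₂' =>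
    PMF.pure (Q + E.toNat, ((X₁', X₂'), (ψ₁', ψ₂')))
  else
    (coin (sys.C ψ₁ ψ₂) (sys.C_mem ψ₁ ψ₂)).bind fun useServer₂ =>
    if useServer₂ then
      (coin (sys.server₂.μ X₂) (sys.server₂.μ_mem X₂)).bind fun I =>
      (pmfOfVector _ (row_mem_stdSimplex sys.belief₁.N_mem ψ₁)).bind fun ψ₁' =>
      (if I then pmfOfVector _ (row_mem_stdSimplex sys.belief₂.S_mem ψ₂)
        else pmfOfVector _ (row_mem_stdSimplex sys.belief₂.F_mem ψ₂)).bind fun ψ₂' =>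
      PMF.pure (Q + E.toNat - I.toNat, ((X₁', X₂'), (ψ₁', ψ₂')))
    else
      (coin (sys.server₁.μ X₁) (sys.server₁.μ_mem X₁)).bind fun I =>
      (if I then pmfOfVector _ (row_mem_stdSimplex sys.belief₁.S_mem ψ₁)
        else pmfOfVector _ (row_mem_stdSimplex sys.belief₁.F_mem ψ₁)).bind fun ψ₁' =>
      (pmfOfVector _ (row_mem_stdSimplex sys.belief₂.N_mem ψ₂)).bind fun ψ₂' =>
      PMF.pure (Q + E.toNat - I.toNat, ((X₁', X₂'), (ψ₁', ψ₂')))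

/-- The diagonal matrix of the probabilities of selecting server 2. -/
def D₂ : Matrix (Fin M × Fin M) (Fin M × Fin M) ℝ :=
  Matrix.diagonal (Matrix.vec sys.Cᵀ)

/-- The diagonal matrix of the probabilities of selecting server 1. -/
def D₁ : Matrix (Fin M × Fin M) (Fin M × Fin M) ℝ :=
  Matrix.diagonal (Matrix.vec (Matrix.of fun i j => 1 - sys.C i j)ᵀ)

/-- Belief transitions together with a service success, in the environment `x = (k, l)`. -/
def Senv (x : Env) : Matrix (Fin M × Fin M) (Fin M × Fin M) ℝ :=
  sys.server₂.μ x.2 • (sys.D₂ * (sys.belief₁.N ⊗ₖ sys.belief₂.S)) +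
    sys.server₁.μ x.1 • (sys.D₁ * (sys.belief₁.S ⊗ₖ sys.belief₂.N))

/-- Belief transitions together with a service failure, in the environment `x = (k, l)`. -/
def Fenv (x : Env) : Matrix (Fin M × Fin M) (Fin M × Fin M) ℝ :=
  (1 - sys.server₂.μ x.2) • (sys.D₂ * (sys.belief₁.N ⊗ₖ sys.belief₂.F)) +
    (1 - sys.server₁.μ x.1) • (sys.D₁ * (sys.belief₁.F ⊗ₖ sys.belief₂.N))

/-- Belief transitions without a service attempt. -/
def Nenv (_x : Env) : Matrix (Fin M × Fin M) (Fin M × Fin M) ℝ :=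
  sys.belief₁.N ⊗ₖ sys.belief₂.N

/-- Phase transitions together with a service success. -/
def Stilde : Matrix (Phase M) (Phase M) ℝ :=
  blockScale (sys.server₁.P ⊗ₖ sys.server₂.P) sys.Senv

/-- Phase transitions together with a service failure. -/
def Ftilde : Matrix (Phase M) (Phase M) ℝ :=
  blockScale (sys.server₁.P ⊗ₖ sys.server₂.P) sys.Fenv

/-- Phase transitions without a service attempt. -/
def Ntilde : Matrix (Phase M) (Phase M) ℝ :=
  blockScale (sys.server₁.P ⊗ₖ sys.server₂.P) sys.Nenv

/-- The block of transitions one level down. -/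
def Adown (lam : ℝ) : Matrix (Phase M) (Phase M) ℝ := (1 - lam) • sys.Stilde

/-- The block of transitions within a level. -/
def Asame (lam : ℝ) : Matrix (Phase M) (Phase M) ℝ :=
  (1 - lam) • sys.Ftilde + lam • sys.Stilde

/-- The block of transitions one level up. -/
def Aup (lam : ℝ) : Matrix (Phase M) (Phase M) ℝ := lam • sys.Ftilde

/-- The stability bound `π S̃ 1`; it does not involve the arrival rate. -/
def muStar (π : Phase M → ℝ) : ℝ := π ⬝ᵥ (sys.Stilde *ᵥ 1)

end ControlledSystem

end

/-!
Write `d = (A₁ - A₋₁) 1` for the mean change of the queue length in one slot, as a function of the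
phase; as `S̃ + F̃` is stochastic, `d = λ 1 - S̃ 1`, and its stationary mean is `λ - μ*`. Two
ingredients turn `λ < μ*` into stability.

*A Lyapunov function.* Every left-invariant vector of a stochastic matrix is a combination of
nonnegative ones, since `|y|` is invariant if `y` is (`abs_vecMul_eq_of_vecMul_eq`). So if the
stationary distribution `π` is unique, the left kernel of `1 - (S̃ + F̃)` is the line through `π`,
and Poisson's equation `h - (S̃ + F̃) h = d - π d` has a solution (`exists_poisson_solution`). With
`ε = μ* - λ`, the function `(n + h φ) / ε` of the level `n` and the phase `φ` then decreases in the
mean by exactly one in each slot with `n ≥ 1` (`ControlledSystem.exists_isDriftCertificate`), and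
Foster's criterion (`meanReturnTime_le_of_drift`) bounds the mean time to reach level `0`.

*From level `0` to single states.* Level `0` is finite. For an essential state `z`, the target
consisting of `z` and of the states in level `0` accessible from `z` is reached in finite mean
time, and the states other than `z` can be removed from it one at a time: from each such state `a`
the chain reaches `z`, hence with positive probability visits the rest of the target before it is
back at `a` (`IsDriftCertificate.exists_diff_singleton`).

Lyapunov functions take values in `[0, ∞]`; being infinite off a closed set of states, they
localise Foster's criterion to that set.
-/

/-! ### Foster's criterion for the mean hitting time of a set -/

section HittingTimes

variable {S : Type} [MeasurableSpace S] [Countable S] [MeasurableSingletonClass S]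

open ProbabilityTheory in
/-- The Markov property at time `n`: a function of the trajectory up to time `n`, times a function
of the next state. -/
lemma lintegral_chainLaw_succ (K : S → PMF S) (z : S) (n : ℕ)
    (g : ((i : Finset.Iic n) → S) → ℝ≥0∞) (f : S → ℝ≥0∞) :
    ∫⁻ x, g (Preorder.frestrictLe n x) * f (x (n + 1)) ∂(chainLaw K z) =
      ∫⁻ x, g (Preorder.frestrictLe n x) * ∑' w, K (x n) w * f w ∂(chainLaw K z) := by
  have hg : Measurable g := measurable_of_countable g
  have hf : Measurable f := measurable_of_countable f
  have hF : Measurable fun p : ((i : Finset.Iic n) → S) × S => g p.1 * f p.2 := by fun_prop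
  have hmap := Kernel.partialTraj_compProd_eq_map_traj (X := fun _ : ℕ => S)
    (κ := stepKernel K) (Nat.zero_le n) (x₀ := fun _ => z)
  have h₁ : ∫⁻ x, g (Preorder.frestrictLe n x) * f (x (n + 1)) ∂(chainLaw K z) =
      ∫⁻ p, g p.1 * f p.2
        ∂((Kernel.partialTraj (X := fun _ : ℕ => S) (stepKernel K) 0 n (fun _ => z)) ⊗ₘ
          stepKernel K n) := by
    rw [hmap, lintegral_map hF (by fun_prop)]
    rfl
  rw [h₁, Measure.lintegral_compProd hF,
    ← Kernel.traj_map_frestrictLe_apply, lintegral_map (measurable_of_countable _) (by fun_prop)]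
  refine lintegral_congr fun x => ?_
  refine (lintegral_const_mul (μ := stepKernel K n (Preorder.frestrictLe n x))
    (g (Preorder.frestrictLe n x)) hf).trans ?_
  rw [lintegral_countable']
  congr 1
  refine tsum_congr fun w => ?_
  rw [mul_comm]
  congr 1
  exact PMF.toMeasure_apply_singleton _ _ (measurableSet_singleton w)

/-- The indicator of the event that `B` is not visited at the times `1, …, n`. -/
noncomputable def avoids (B : Set S) (n : ℕ) (h : (i : Finset.Iic n) → S) : ℝ≥0∞ :=
  {h : (i : Finset.Iic n) → S | ∀ i : Finset.Iic n, 1 ≤ (i : ℕ) → h i ∉ B}.indicator 1 h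

omit [MeasurableSpace S] [Countable S] [MeasurableSingletonClass S] in
lemma avoids_succ (B : Set S) (n : ℕ) (x : ℕ → S) :
    avoids B (n + 1) (Preorder.frestrictLe (n + 1) x) =
      avoids B n (Preorder.frestrictLe n x) * Bᶜ.indicator 1 (x (n + 1)) := by
  classical
  by_cases h : x (n + 1) ∈ B
  · rw [avoids, Set.indicator_of_notMem, Set.indicator_of_notMem (by simpa using h), mul_zero]
    exact fun h' => h' ⟨n + 1, by simp⟩ (by simp) h
  · rw [Set.indicator_of_mem (by simpa using h), Pi.one_apply, mul_one, avoids, avoids]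
    refine Set.indicator_eq_indicator ?_ rfl
    simp only [Set.mem_ofPred_eq, Subtype.forall, Finset.mem_Iic, Preorder.frestrictLe_apply]
    refine ⟨fun h' i hi => h' i (by omega), fun h' i hi h1 => ?_⟩
    rcases Nat.lt_or_eq_of_le hi with hi | rfl
    · exact h' i (by omega) h1
    · exact h

omit [MeasurableSpace S] [Countable S] [MeasurableSingletonClass S] in
/-- The return time is at most the number of times `n` up to which `B` has been avoided. -/
lemma returnTime_le_tsum_avoids (B : Set S) (x : ℕ → S) :
    returnTime B x ≤ ∑' n, avoids B n (Preorder.frestrictLe n x) := by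
  classical
  by_cases hex : ∃ n, 1 ≤ n ∧ x n ∈ B
  · have hs := Nat.find_spec hex
    have hmin : ∀ m < Nat.find hex, avoids B m (Preorder.frestrictLe m x) = 1 := by
      intro m hm
      refine Set.indicator_of_mem ?_ 1
      intro i h1 hB
      have hi := Finset.mem_Iic.1 i.2
      exact Nat.find_min hex (lt_of_le_of_lt hi hm) ⟨h1, hB⟩
    calc returnTime B x ≤ (Nat.find hex : ℝ≥0∞) :=
          iInf_le (fun n : {n : ℕ // 1 ≤ n ∧ x n ∈ B} => ((n : ℕ) : ℝ≥0∞)) ⟨_, hs⟩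
      _ = ∑ n ∈ Finset.range (Nat.find hex), avoids B n (Preorder.frestrictLe n x) := by
          rw [Finset.sum_congr rfl fun m hm => hmin m (Finset.mem_range.1 hm)]
          simp
      _ ≤ _ := ENNReal.sum_le_tsum _
  · have h1 : ∀ n, avoids B n (Preorder.frestrictLe n x) = 1 := fun n =>
      Set.indicator_of_mem (Set.mem_ofPred_eq ▸ fun i h1 hB => hex ⟨i, h1, hB⟩) 1
    simp only [h1]
    simp

/-- **Foster's criterion.** A function `W` that decreases by at least one in the mean as long as
`B` is not entered bounds the mean time until `B` is entered. -/
theorem meanReturnTime_le_of_drift (K : S → PMF S) (B : Set S) (W : S → ℝ≥0∞)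
    (hW : ∀ x, 1 + ∑' w, K x w * Bᶜ.indicator W w ≤ W x) (z : S) :
    meanReturnTime K B z ≤ W z := by
  have hav : ∀ n, Measurable (avoids B n) := fun n => measurable_of_countable _
  have hWm : Measurable W := measurable_of_countable _
  let a : ℕ → ℝ≥0∞ := fun n => ∫⁻ x, avoids B n (Preorder.frestrictLe n x) ∂(chainLaw K z)
  let b : ℕ → ℝ≥0∞ := fun n =>
    ∫⁻ x, avoids B n (Preorder.frestrictLe n x) * W (x n) ∂(chainLaw K z)
  have hab : ∀ n, a n + b (n + 1) ≤ b n := by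
    intro n
    have hb : b (n + 1) = ∫⁻ x, avoids B n (Preorder.frestrictLe n x) *
        ∑' w, K (x n) w * Bᶜ.indicator W w ∂(chainLaw K z) := by
      rw [← lintegral_chainLaw_succ]
      refine lintegral_congr fun x => ?_
      rw [avoids_succ, mul_assoc]
      congr 1
      by_cases h : x (n + 1) ∈ Bᶜ <;> simp [h]
    rw [hb, ← lintegral_add_left (by fun_prop)]
    refine lintegral_mono fun x => ?_
    calc _ = avoids B n (Preorder.frestrictLe n x) *
          (1 + ∑' w, K (x n) w * Bᶜ.indicator W w) := by rw [mul_add, mul_one]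
      _ ≤ _ := by gcongr; exact hW _
  have hsum : ∀ n, ∑ i ∈ Finset.range n, a i + b n ≤ b 0 := by
    intro n
    induction n with
    | zero => simp
    | succ n ih =>
      rw [Finset.sum_range_succ, add_assoc]
      exact (add_le_add_right (hab n) _).trans ih
  have hb0 : b 0 ≤ W z := by
    have h0 : b 0 = ∫⁻ h, avoids B 0 h * W (h ⟨0, by simp⟩) ∂(ProbabilityTheory.Kernel.partialTraj
        (X := fun _ : ℕ => S) (stepKernel K) 0 0 (fun _ => z)) := by
      rw [← ProbabilityTheory.Kernel.traj_map_frestrictLe_apply,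
        lintegral_map (measurable_of_countable _) (by fun_prop)]
      rfl
    rw [h0, ProbabilityTheory.Kernel.partialTraj_self, ProbabilityTheory.Kernel.lintegral_id]
    refine mul_le_of_le_one_left' ?_
    exact Set.indicator_le' (fun _ _ => le_rfl) (fun _ _ => zero_le) _
  calc meanReturnTime K B z
      ≤ ∫⁻ x, ∑' n, avoids B n (Preorder.frestrictLe n x) ∂(chainLaw K z) :=
        lintegral_mono fun x => returnTime_le_tsum_avoids B x
    _ = ∑' n, a n := lintegral_tsum fun n => by fun_prop
    _ ≤ W z := by
        rw [ENNReal.tsum_eq_iSup_nat]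
        exact iSup_le fun n => le_self_add.trans ((hsum n).trans hb0)

end HittingTimes

/-! ### Positive recurrence of essential states -/

section PositiveRecurrence

variable {S : Type}

/-- `W` certifies, by Foster's criterion, that the target `B` is reached in finite mean time from
all states of `C`. -/
def IsDriftCertificate (K : S → PMF S) (B C : Set S) (W : S → ℝ≥0∞) : Prop :=
  (∀ x ∈ C, W x < ∞) ∧ ∀ x ∈ C, 1 + ∑' w, K x w * Bᶜ.indicator W w ≤ W x

lemma IsDriftCertificate.meanReturnTime_lt_top [MeasurableSpace S] [Countable S]
    [MeasurableSingletonClass S] {K : S → PMF S} {B C : Set S} {W : S → ℝ≥0∞}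
    (hW : IsDriftCertificate K B C W) (hC : ∀ x ∈ C, ∀ y, K x y ≠ 0 → y ∈ C) {z : S}
    (hz : z ∈ C) : meanReturnTime K B z < ∞ := by
  classical
  -- off the closed set `C` the bound may be infinite
  have h := meanReturnTime_le_of_drift K B (fun x => if x ∈ C then W x else ∞) ?_ z
  · exact h.trans_lt (by simpa [hz] using hW.1 z hz)
  · intro x
    by_cases hx : x ∈ C
    · refine le_trans (le_of_eq ?_) ((hW.2 x hx).trans_eq (by simp [hx]))
      congr 1
      refine tsum_congr fun w => ?_
      by_cases hw : K x w = 0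
      · simp [hw]
      · congr 1
        by_cases hB : w ∈ Bᶜ <;> simp [hB, hC x hx w hw]
    · simp [hx]

/-- A state `a` can be removed from the target `A` if the chain cannot return to `a` forever
without visiting the rest of `A`. Let `r x` be the probability that the chain from `x` enters `A`
at `a`. Each visit to `a` costs at most `W a`, and is followed by another one with probability
`r a < 1`, so `W + r W(a) / (1 - r a)` is a certificate for `A \ {a}`. -/
lemma IsDriftCertificate.exists_diff_singleton {K : S → PMF S} {A C : Set S} {W : S → ℝ≥0∞}
    (hW : IsDriftCertificate K A C W) {a z : S} (ha : a ∈ A) (haC : a ∈ C) (hz : z ∈ A)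
    (hza : z ≠ a) (hacc : Accessible K a z) :
    ∃ W', IsDriftCertificate K (A \ {a}) C W' := by
  classical
  -- `r` is the least solution of the equations of a first-step analysis
  let Φ : (S → ℝ≥0∞) →o (S → ℝ≥0∞) :=
    ⟨fun f x => ∑' w, K x w * (if w = a then 1 else Aᶜ.indicator f w), fun f g hfg x => by
      refine ENNReal.tsum_le_tsum fun w => ?_
      gcongr
      split_ifs
      · exact le_rfl
      · exact Set.indicator_le_indicator (hfg w)⟩
  let r : S → ℝ≥0∞ := OrderHom.lfp Φ
  have hr : ∀ x, ∑' w, K x w * (if w = a then 1 else Aᶜ.indicator r w) = r x :=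
    fun x => congrFun (OrderHom.map_lfp Φ) x
  have hr1 : ∀ x, r x ≤ 1 := by
    refine OrderHom.lfp_le (f := Φ) (a := fun _ => 1) fun x => ?_
    change ∑' w, K x w * (if w = a then 1 else Aᶜ.indicator (fun _ => 1) w) ≤ 1
    refine (ENNReal.tsum_le_tsum fun w => ?_).trans (K x).tsum_coe.le
    refine mul_le_of_le_one_right' ?_
    split_ifs
    · exact le_rfl
    · exact Set.indicator_le' (fun _ _ => le_rfl) (fun _ _ => zero_le) _
  have hstep : ∀ x, r x = 1 → ∀ y, K x y ≠ 0 → y = a ∨ (y ∉ A ∧ r y = 1) := by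
    intro x hx y hy
    by_contra hcon
    have hlt : (if y = a then 1 else Aᶜ.indicator r y) < 1 := by
      push Not at hcon
      rw [if_neg hcon.1]
      by_cases hyA : y ∈ A
      · simp [hyA]
      · simpa [hyA] using lt_of_le_of_ne (hr1 y) (hcon.2 hyA)
    have : ∑' w, K x w * (if w = a then 1 else Aᶜ.indicator r w) < ∑' w, K x w := by
      refine ENNReal.tsum_lt_tsum (i := y) ?_ (fun w => mul_le_of_le_one_right' ?_) ?_
      · rw [hr, hx]; exact ENNReal.one_ne_top
      · split_ifs
        · exact le_rfl
        · exact (Set.indicator_le_self _ _ _).trans (hr1 w)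
      · calc _ < K x y * 1 := (ENNReal.mul_lt_mul_iff_right hy ((K x).apply_ne_top y)).2 hlt
          _ = _ := mul_one _
    rw [hr, hx, (K x).tsum_coe] at this
    exact lt_irrefl _ this
  -- otherwise the states `x` with `r x = 1` outside `A \ {a}` form a closed set without `z`
  have hra : r a < 1 := by
    refine lt_of_le_of_ne (hr1 a) fun h1 => ?_
    have hclosed : ∀ y, Accessible K a y → r y = 1 ∧ (y = a ∨ y ∉ A) := by
      intro y hy
      induction hy with
      | refl => exact ⟨h1, Or.inl rfl⟩
      | tail _ hbc ih =>
        rcases hstep _ ih.1 _ hbc with rfl | h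
        · exact ⟨h1, Or.inl rfl⟩
        · exact ⟨h.2, Or.inr h.1⟩
    rcases (hclosed z hacc).2 with h | h
    · exact hza h
    · exact h hz
  have h1r : 1 - r a ≠ 0 := (tsub_pos_of_lt hra).ne'
  have h1r' : 1 - r a ≠ ∞ := ENNReal.sub_ne_top ENNReal.one_ne_top
  let c : ℝ≥0∞ := W a / (1 - r a)
  have hc : c < ∞ := ENNReal.div_lt_top (hW.1 a haC).ne h1r
  have hca : W a + c * r a = c := by
    have : c * (1 - r a) = W a := ENNReal.div_mul_cancel h1r h1r'
    rw [← this, ← mul_add, tsub_add_cancel_of_le hra.le, mul_one]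
  refine ⟨fun x => W x + c * r x, fun x hx => ?_, fun x hx => ?_⟩
  · exact ENNReal.add_lt_top.2
      ⟨hW.1 x hx, ENNReal.mul_lt_top hc ((hr1 x).trans_lt ENNReal.one_lt_top)⟩
  · have hsplit : ∀ w, K x w * (A \ {a})ᶜ.indicator (fun x => W x + c * r x) w =
        K x w * Aᶜ.indicator W w + c * (K x w * (if w = a then 1 else Aᶜ.indicator r w)) := by
      intro w
      by_cases hwa : w = a
      · subst hwa
        simp [ha, mul_comm (K x w), hca]
      · by_cases hwA : w ∈ A
        · simp [hwa, hwA]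
        · simp [hwa, hwA]; ring
    rw [tsum_congr hsplit, ENNReal.tsum_add, ENNReal.tsum_mul_left, hr, ← add_assoc]
    exact add_le_add (hW.2 x hx) le_rfl

/-- All states `x ≠ z` of a finite target can be removed from it, provided that `z` is accessible
from them. -/
lemma IsDriftCertificate.exists_singleton {K : S → PMF S} {C : Set S} {z : S}
    (hacc : ∀ x ∈ C, Accessible K x z) (F : Finset S) (hF : ∀ x ∈ F, x ∈ C) (hz : z ∉ F)
    {W : S → ℝ≥0∞} (hW : IsDriftCertificate K (insert z (F : Set S)) C W) :
    ∃ W', IsDriftCertificate K {z} C W' := by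
  classical
  induction F using Finset.induction_on generalizing W with
  | empty => exact ⟨W, by simpa using hW⟩
  | insert a F haF ih =>
    have hza : z ≠ a := fun h => hz (by simp [h])
    obtain ⟨W', hW'⟩ := hW.exists_diff_singleton (a := a) (z := z) (by simp)
      (hF a (by simp)) (by simp) hza (hacc a (hF a (by simp)))
    refine ih (fun x hx => hF x (by simp [hx])) (fun h => hz (by simp [h])) (W := W') ?_
    convert hW' using 1
    ext x
    have : x = a → x ∉ F := fun h => h ▸ haF
    simp only [Set.mem_insert_iff, Finset.mem_coe, Finset.coe_insert, Set.mem_sdiff,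
      Set.mem_singleton_iff]
    grind

/-- If the chain reaches a finite set `B` in finite mean time from everywhere, then its essential
states are positive recurrent. -/
theorem isPositiveRecurrent_of_isEssential [MeasurableSpace S] [Countable S]
    [MeasurableSingletonClass S] {K : S → PMF S} {B : Set S} (hB : B.Finite) {W : S → ℝ≥0∞}
    (hW : IsDriftCertificate K B Set.univ W) {z : S} (hz : IsEssential K z) :
    IsPositiveRecurrent K z := by
  classical
  let C : Set S := {x | Accessible K z x}
  have hC : ∀ x ∈ C, ∀ y, K x y ≠ 0 → y ∈ C := fun x hx y hy => Relation.ReflTransGen.tail hx hy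
  have hfin : ((B ∩ C) \ {z}).Finite := (hB.inter_of_left C).sdiff
  have hW' : IsDriftCertificate K (insert z (hfin.toFinset : Set S)) C W := by
    refine ⟨fun x _ => hW.1 x trivial, fun x hx => le_trans ?_ (hW.2 x trivial)⟩
    gcongr 1 + ?_
    refine ENNReal.tsum_le_tsum fun w => ?_
    by_cases hw : K x w = 0
    · simp [hw]
    · refine mul_le_mul' le_rfl ?_
      by_cases hwB : w ∈ B
      · have hwC := hC x hx w hw
        have : w ∈ insert z (hfin.toFinset : Set S) := by
          by_cases hwz : w = z <;> simp [hwz, hwB, hwC]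
        rw [Set.indicator_of_notMem (Set.notMem_compl_iff.2 this)]
        exact zero_le
      · rw [Set.indicator_of_mem (show w ∈ Bᶜ from hwB)]
        exact Set.indicator_le_self _ _ _
  obtain ⟨W', h⟩ := hW'.exists_singleton (C := C) hz hfin.toFinset
    (fun x hx => ((hfin.mem_toFinset.1 hx).1).2) (by simp)
  exact h.meanReturnTime_lt_top hC Relation.ReflTransGen.refl

end PositiveRecurrence

/-! ### Stationary distributions and Poisson's equation of a stochastic matrix -/

section Stationary

variable {ι : Type} [Fintype ι] [DecidableEq ι] {P : Matrix ι ι ℝ}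

/-- Summing `|y| ≤ |y| P` over all states gives equality, since `P` preserves the total mass. -/
lemma abs_vecMul_eq_of_vecMul_eq (hP : P ∈ rowStochastic ℝ ι) {y : ι → ℝ} (hy : y ᵥ* P = y) :
    (fun i => |y i|) ᵥ* P = fun i => |y i| := by
  have hle : ∀ j, |y j| ≤ ((fun i => |y i|) ᵥ* P) j := by
    intro j
    conv_lhs => rw [← hy]
    simp only [vecMul, dotProduct]
    refine (Finset.abs_sum_le_sum_abs _ _).trans_eq (Finset.sum_congr rfl fun i _ => ?_)
    rw [abs_mul, abs_of_nonneg (hP.1 i j)]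
  have hsum : ∑ j, |y j| = ∑ j, ((fun i => |y i|) ᵥ* P) j := by
    simp only [vecMul, dotProduct]
    rw [Finset.sum_comm]
    refine Finset.sum_congr rfl fun i _ => ?_
    rw [← Finset.mul_sum, sum_row_of_mem_rowStochastic hP, mul_one]
  have := (Finset.sum_eq_sum_iff_of_le fun j _ => hle j).1 hsum
  exact funext fun j => (this j (Finset.mem_univ j)).symm

omit [DecidableEq ι] in
/-- A nonnegative invariant vector is a multiple of a stationary distribution. -/
lemma isStationaryDistribution_normalize {y : ι → ℝ} (hy : y ᵥ* P = y) (h0 : ∀ i, 0 ≤ y i)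
    (hs : ∑ i, y i ≠ 0) : IsStationaryDistribution P ((∑ i, y i)⁻¹ • y) := by
  refine ⟨⟨fun i => ?_, ?_⟩, ?_⟩
  · exact mul_nonneg (inv_nonneg.2 (Finset.sum_nonneg fun i _ => h0 i)) (h0 i)
  · simp [← Finset.mul_sum, hs]
  · rw [smul_vecMul, hy]

/-- The matrix `1 - P` kills the constant vector, hence also some row vector `y`; then `|y|` is
invariant. -/
theorem exists_isStationaryDistribution [Nonempty ι] (hP : P ∈ rowStochastic ℝ ι) :
    ∃ π : ι → ℝ, IsStationaryDistribution P π := by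
  have hdet : (1 - P).det = 0 := by
    refine exists_mulVec_eq_zero_iff.1 ⟨1, one_ne_zero, ?_⟩
    rw [sub_mulVec, one_mulVec, hP.2, sub_self]
  obtain ⟨y, hy0, hy⟩ := exists_vecMul_eq_zero_iff.2 hdet
  rw [vecMul_sub, vecMul_one, sub_eq_zero] at hy
  refine ⟨_, isStationaryDistribution_normalize (abs_vecMul_eq_of_vecMul_eq hP hy.symm)
    (fun i => abs_nonneg _) fun h => hy0 ?_⟩
  funext i
  simpa using (Finset.sum_eq_zero_iff_of_nonneg fun i _ => abs_nonneg (y i)).1 h i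
    (Finset.mem_univ i)

/-- If the stationary distribution `π` is unique, then `y + |y|` and `|y|` are multiples of `π`,
and so is every invariant vector `y`. -/
lemma exists_smul_of_vecMul_eq (hP : P ∈ rowStochastic ℝ ι) {π : ι → ℝ}
    (huniq : ∀ π' : ι → ℝ, IsStationaryDistribution P π' → π' = π)
    {y : ι → ℝ} (hy : y ᵥ* P = y) : ∃ c : ℝ, y = c • π := by
  have key : ∀ u : ι → ℝ, u ᵥ* P = u → (∀ i, 0 ≤ u i) → ∃ c : ℝ, u = c • π := by
    intro u hu h0
    by_cases hs : ∑ i, u i = 0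
    · refine ⟨0, ?_⟩
      funext i
      simpa using (Finset.sum_eq_zero_iff_of_nonneg fun i _ => h0 i).1 hs i (Finset.mem_univ i)
    · refine ⟨∑ i, u i, ?_⟩
      rw [← huniq _ (isStationaryDistribution_normalize hu h0 hs), smul_smul, mul_inv_cancel₀ hs,
        one_smul]
  have habs := abs_vecMul_eq_of_vecMul_eq hP hy
  obtain ⟨c, hc⟩ := key _ habs fun i => abs_nonneg _
  obtain ⟨c', hc'⟩ := key (y + fun i => |y i|) (by rw [add_vecMul, hy, habs])
    fun i => by simpa using neg_le_iff_add_nonneg'.1 (neg_abs_le (y i)) |>.trans_eq (add_comm _ _)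
  refine ⟨c' - c, ?_⟩
  rw [sub_smul, ← hc', ← hc, add_sub_cancel_right]

/-- **Poisson's equation** `h - P h = d - π d`, for a stochastic matrix with a unique stationary
distribution: the right-hand side is orthogonal to the left kernel `ℝ π` of `1 - P`. -/
theorem exists_poisson_solution (hP : P ∈ rowStochastic ℝ ι) {π : ι → ℝ}
    (hπ : IsStationaryDistribution P π)
    (huniq : ∀ π' : ι → ℝ, IsStationaryDistribution P π' → π' = π) (d : ι → ℝ) :
    ∃ h : ι → ℝ, ∀ i, h i - (P *ᵥ h) i = d i - π ⬝ᵥ d := by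
  let g : ι → ℝ := d - (π ⬝ᵥ d) • 1
  suffices hg : g ∈ LinearMap.range (mulVecLin (1 - P)) by
    obtain ⟨h, hh⟩ := hg
    refine ⟨h, fun i => ?_⟩
    have := congrFun hh i
    simpa [sub_mulVec, g] using this
  by_contra hg
  obtain ⟨f, hf, hker⟩ := Submodule.exists_le_ker_of_notMem hg
  let y : ι → ℝ := fun i => f (Pi.single i 1)
  have hfy : ∀ v : ι → ℝ, f v = y ⬝ᵥ v := by
    intro v
    conv_lhs => rw [pi_eq_sum_univ' v]
    simp [dotProduct, y, mul_comm]
  have hy : y ᵥ* (1 - P) = 0 := by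
    refine dotProduct_eq_zero _ fun v => ?_
    rw [← dotProduct_mulVec, ← hfy]
    exact hker ⟨v, rfl⟩
  rw [vecMul_sub, vecMul_one, sub_eq_zero] at hy
  obtain ⟨c, hc⟩ := exists_smul_of_vecMul_eq hP huniq hy.symm
  refine hf ?_
  have h1 : π ⬝ᵥ (1 : ι → ℝ) = 1 := by simpa [dotProduct] using hπ.1.2
  rw [hfy, hc, smul_dotProduct, dotProduct_sub, dotProduct_smul, h1]
  simp

omit [DecidableEq ι] in
/-- A nonnegative invariant vector of an irreducible matrix that vanishes somewhere is zero: the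
zeros propagate backwards along the edges. -/
lemma eq_zero_of_isIrreducible (hirr : P.IsIrreducible) {u : ι → ℝ} (hu : u ᵥ* P = u)
    (h0 : ∀ i, 0 ≤ u i) {j : ι} (hj : u j = 0) : u = 0 := by
  let : Quiver ι := P.toQuiver
  have hstep : ∀ a b : ι, 0 < P a b → u b = 0 → u a = 0 := by
    intro a b hab hb
    have hsum : ∑ i, u i * P i b = 0 := by
      have := congrFun hu b
      rwa [hb] at this
    have := (Finset.sum_eq_zero_iff_of_nonneg fun i _ =>
      mul_nonneg (h0 i) (hirr.nonneg i b)).1 hsum a (Finset.mem_univ a)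
    exact (mul_eq_zero.1 this).resolve_right hab.ne'
  funext i
  obtain ⟨p, -⟩ := hirr.connected i j
  induction p with
  | nil => exact hj
  | cons p e ih => exact ih (hstep _ _ e.down hj)

theorem existsUnique_isStationaryDistribution [Nonempty ι] (hP : P ∈ rowStochastic ℝ ι)
    (hirr : P.IsIrreducible) : ∃! π : ι → ℝ, IsStationaryDistribution P π := by
  obtain ⟨π, hπ⟩ := exists_isStationaryDistribution hP
  have hpos : ∀ i, 0 < π i := by
    intro i
    refine (hπ.1.1 i).lt_of_ne' fun hi => ?_
    have := hπ.1.2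
    rw [eq_zero_of_isIrreducible hirr hπ.2 hπ.1.1 hi] at this
    simp at this
  refine ⟨π, hπ, fun π' hπ' => ?_⟩
  -- `c` is the largest constant with `c π ≤ π'`, so `π' - c π` has a zero
  obtain ⟨j, hj⟩ := Finite.exists_min fun i => π' i / π i
  have hz : π' - (π' j / π j) • π = 0 := by
    refine eq_zero_of_isIrreducible (j := j) hirr ?_ (fun i => ?_) ?_
    · rw [sub_vecMul, smul_vecMul, hπ.2, hπ'.2]
    · have := (le_div_iff₀ (hpos i)).1 (hj i)
      simpa using this
    · simp [(hpos j).ne']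
  have h1 : π' = (π' j / π j) • π := sub_eq_zero.1 hz
  have hc : π' j / π j = 1 := by
    have h2 := hπ'.1.2
    rw [h1] at h2
    simpa [← Finset.mul_sum, hπ.1.2] using h2
  rw [h1, hc, one_smul]

end Stationary

/-! ### The one-step law of the two-server system -/

section Step

lemma toReal_bind_apply {α β : Type} [Fintype α] (p : PMF α) (f : α → PMF β) (b : β) :
    ((p.bind f) b).toReal = ∑ a, (p a).toReal * (f a b).toReal := by
  rw [PMF.bind_apply, tsum_fintype, ENNReal.toReal_sum]
  · simp
  · exact fun a _ => ENNReal.mul_ne_top (p.apply_ne_top a) ((f a).apply_ne_top b)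

lemma toReal_pmfOfVector {α : Type} [Fintype α] (f : α → ℝ) (hf : f ∈ stdSimplex ℝ α) (a : α) :
    ((pmfOfVector f hf) a).toReal = f a :=
  ENNReal.toReal_ofReal (hf.1 a)

lemma toReal_coin (p : ℝ) (hp : p ∈ Set.Icc (0 : ℝ) 1) (b : Bool) :
    ((coin p hp) b).toReal = if b then p else 1 - p :=
  toReal_pmfOfVector _ _ _

lemma toReal_pure_apply {α : Type} [DecidableEq α] (a b : α) :
    ((PMF.pure a) b).toReal = if b = a then 1 else 0 := by
  rw [PMF.pure_apply]
  split_ifs <;> simp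

namespace ControlledSystem

variable {M : ℕ} (sys : ControlledSystem M)

/-- The law of `Z(t+1)` given `Z(t)` is the row of the QBD matrix. For `n ≥ 1` the four combinations
of arrival and service outcome lead to the levels `n - 1`, `n` (twice) and `n + 1`. -/
theorem toReal_step (lam : ℝ) (hlam : lam ∈ Set.Icc (0 : ℝ) 1) (z w : State M) :
    (sys.step lam hlam z w).toReal =
      qbdMatrix ((1 - lam) • sys.Ntilde) (lam • sys.Ntilde)
        (sys.Adown lam) (sys.Asame lam) (sys.Aup lam) z w := by
  obtain ⟨n, ⟨k, l⟩, i, j⟩ := z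
  obtain ⟨n', ⟨k', l'⟩, i', j'⟩ := w
  rcases n with _ | n
  · simp only [step, if_true, toReal_bind_apply, toReal_pmfOfVector, toReal_coin,
      toReal_pure_apply, Fintype.sum_bool, Prod.mk.injEq, ite_and, mul_ite, mul_one, mul_zero,
      Finset.sum_ite_irrel, Finset.sum_const_zero, Finset.sum_ite_eq, Finset.mem_univ]
    rcases n' with _ | _ | n' <;>
    simp [qbdMatrix, Ntilde, blockScale, Nenv] <;> exact Or.inl (by ring)
  · simp only [step, toReal_bind_apply, toReal_pmfOfVector, toReal_coin,
      toReal_pure_apply, Fintype.sum_bool, Prod.mk.injEq, ite_and, mul_ite, mul_one, mul_zero,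
      Finset.sum_ite_irrel, Finset.sum_const_zero, Finset.sum_ite_eq, Finset.mem_univ, if_true,
      Nat.add_eq_zero_iff, one_ne_zero, and_false, if_false, Bool.false_eq_true]
    have e₁ : n + 1 + true.toNat - true.toNat = n + 1 := by simp
    have e₂ : n + 1 + true.toNat - false.toNat = n + 2 := by simp
    have e₃ : n + 1 + false.toNat - true.toNat = n := by simp
    have e₄ : n + 1 + false.toNat - false.toNat = n + 1 := by simp
    rw [e₁, e₂, e₃, e₄]
    simp only [mul_add, mul_ite, mul_zero, Finset.sum_add_distrib, Finset.sum_ite_irrel,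
      Finset.sum_const_zero, Finset.sum_ite_eq, Finset.mem_univ, if_true]
    by_cases h₁ : n' = n
    · subst h₁
      simp [qbdMatrix, Adown, Stilde, blockScale, Senv, D₁, D₂, vec]
      ring
    by_cases h₂ : n' = n + 1
    · subst h₂
      simp [qbdMatrix, Asame, Stilde, Ftilde, blockScale, Senv, Fenv, D₁, D₂, vec]
      ring
    by_cases h₃ : n' = n + 2
    · subst h₃
      simp [qbdMatrix, Aup, Ftilde, blockScale, Fenv, D₁, D₂, vec]
      ring
    · simp [qbdMatrix, h₁, h₂, h₃]

end ControlledSystem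
end Step

/-! ### Drift and stability of the two-server system -/

section Stability

lemma blockScale_mem_rowStochastic {e φ : Type} [Fintype e] [DecidableEq e] [Fintype φ]
    [DecidableEq φ] {P : Matrix e e ℝ} (hP : P ∈ rowStochastic ℝ e) {B : e → Matrix φ φ ℝ}
    (hB : ∀ a, B a ∈ rowStochastic ℝ φ) : blockScale P B ∈ rowStochastic ℝ (e × φ) := by
  refine mem_rowStochastic_iff_sum.2 ⟨fun x y => ?_, fun x => ?_⟩
  · exact mul_nonneg (hP.1 _ _) ((hB _).1 _ _)
  · simp only [blockScale, of_apply, Fintype.sum_prod_type, ← Finset.mul_sum,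
      sum_row_of_mem_rowStochastic (hB _), sum_row_of_mem_rowStochastic hP, mul_one]

lemma kronecker_mem_rowStochastic {m n : Type} [Fintype m] [DecidableEq m] [Fintype n]
    [DecidableEq n] {A : Matrix m m ℝ} {B : Matrix n n ℝ} (hA : A ∈ rowStochastic ℝ m)
    (hB : B ∈ rowStochastic ℝ n) : A ⊗ₖ B ∈ rowStochastic ℝ (m × n) :=
  blockScale_mem_rowStochastic (B := fun _ => B) hA fun _ => hB

lemma Server.P_mem_rowStochastic (s : Server) : s.P ∈ rowStochastic ℝ (Fin 2) :=
  mem_rowStochastic_iff_sum.2 ⟨fun i => (s.P_row i).1, fun i => (s.P_row i).2⟩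

namespace ControlledSystem

variable {M : ℕ} (sys : ControlledSystem M)

lemma Senv_add_Fenv_mem_rowStochastic (x : Env) :
    sys.Senv x + sys.Fenv x ∈ rowStochastic ℝ (Fin M × Fin M) := by
  have h₁ := sys.server₁.μ_mem x.1
  have h₂ := sys.server₂.μ_mem x.2
  have hNS := kronecker_mem_rowStochastic sys.belief₁.N_mem sys.belief₂.S_mem
  have hNF := kronecker_mem_rowStochastic sys.belief₁.N_mem sys.belief₂.F_mem
  have hSN := kronecker_mem_rowStochastic sys.belief₁.S_mem sys.belief₂.N_mem
  have hFN := kronecker_mem_rowStochastic sys.belief₁.F_mem sys.belief₂.N_mem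
  have hentry : ∀ a b, (sys.Senv x + sys.Fenv x) a b =
      sys.C a.1 a.2 * (sys.server₂.μ x.2 * (sys.belief₁.N ⊗ₖ sys.belief₂.S) a b +
        (1 - sys.server₂.μ x.2) * (sys.belief₁.N ⊗ₖ sys.belief₂.F) a b) +
      (1 - sys.C a.1 a.2) * (sys.server₁.μ x.1 * (sys.belief₁.S ⊗ₖ sys.belief₂.N) a b +
        (1 - sys.server₁.μ x.1) * (sys.belief₁.F ⊗ₖ sys.belief₂.N) a b) := by
    intro a b
    simp only [Senv, Fenv, D₁, D₂, Matrix.add_apply, Matrix.smul_apply, diagonal_mul, vec,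
      transpose_apply, of_apply, smul_eq_mul]
    ring
  refine mem_rowStochastic_iff_sum.2 ⟨fun a b => ?_, fun a => ?_⟩
  · have hC := sys.C_mem a.1 a.2
    have := hNS.1 a b
    have := hNF.1 a b
    have := hSN.1 a b
    have := hFN.1 a b
    have := sub_nonneg.2 h₁.2
    have := sub_nonneg.2 h₂.2
    have := sub_nonneg.2 hC.2
    have := h₁.1
    have := h₂.1
    have := hC.1
    rw [hentry]
    positivity
  · simp only [hentry, Finset.sum_add_distrib, ← Finset.mul_sum, sum_row_of_mem_rowStochastic hNS,
      sum_row_of_mem_rowStochastic hNF, sum_row_of_mem_rowStochastic hSN,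
      sum_row_of_mem_rowStochastic hFN]
    ring

lemma Stilde_add_Ftilde_mem_rowStochastic :
    sys.Stilde + sys.Ftilde ∈ rowStochastic ℝ (Phase M) := by
  have h := blockScale_mem_rowStochastic
    (kronecker_mem_rowStochastic sys.server₁.P_mem_rowStochastic sys.server₂.P_mem_rowStochastic)
    sys.Senv_add_Fenv_mem_rowStochastic
  convert h using 1
  ext x y
  simp [Stilde, Ftilde, blockScale, mul_add]

lemma Ntilde_mem_rowStochastic : sys.Ntilde ∈ rowStochastic ℝ (Phase M) :=
  blockScale_mem_rowStochastic
    (kronecker_mem_rowStochastic sys.server₁.P_mem_rowStochastic sys.server₂.P_mem_rowStochastic)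
    fun _ => kronecker_mem_rowStochastic sys.belief₁.N_mem sys.belief₂.N_mem

lemma Adown_add_Asame_add_Aup (lam : ℝ) :
    sys.Adown lam + sys.Asame lam + sys.Aup lam = sys.Stilde + sys.Ftilde := by
  simp only [Adown, Asame, Aup]
  module

/-- The mean change of the queue length in one slot is `λ - (S̃ 1)(φ)` in phase `φ`. -/
lemma Aup_sub_Adown_mulVec_one (lam : ℝ) :
    (sys.Aup lam - sys.Adown lam) *ᵥ 1 = lam • (1 : Phase M → ℝ) - sys.Stilde *ᵥ 1 := by
  have h : sys.Stilde *ᵥ 1 + sys.Ftilde *ᵥ 1 = 1 := by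
    rw [← add_mulVec, sys.Stilde_add_Ftilde_mem_rowStochastic.2]
  rw [Aup, Adown, sub_mulVec, smul_mulVec, smul_mulVec, eq_sub_of_add_eq' h]
  module

lemma dotProduct_Aup_sub_Adown (lam : ℝ) {π : Phase M → ℝ} (hπ : π ∈ stdSimplex ℝ (Phase M)) :
    π ⬝ᵥ ((sys.Aup lam - sys.Adown lam) *ᵥ 1) = lam - sys.muStar π := by
  have h1 : π ⬝ᵥ (1 : Phase M → ℝ) = 1 := by simpa [dotProduct] using hπ.2
  rw [Aup_sub_Adown_mulVec_one, dotProduct_sub, dotProduct_smul, h1, muStar]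
  simp

variable {lam : ℝ} (hlam : lam ∈ Set.Icc (0 : ℝ) 1)

lemma step_eq_zero {z w : State M} (h : z.1 + 1 < w.1) : sys.step lam hlam z w = 0 := by
  have := sys.toReal_step lam hlam z w
  have h0 : qbdMatrix ((1 - lam) • sys.Ntilde) (lam • sys.Ntilde)
      (sys.Adown lam) (sys.Asame lam) (sys.Aup lam) z w = 0 := by
    simp only [qbdMatrix, of_apply]
    split_ifs <;> first | rfl | omega
  rw [h0, ENNReal.toReal_eq_zero_iff] at this
  exact this.resolve_right ((sys.step lam hlam z).apply_ne_top w)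

/-- Expectations over one step are finite sums, as the queue grows by at most one job. -/
lemma tsum_step_mul (z : State M) (f : State M → ℝ≥0∞) :
    ∑' w, sys.step lam hlam z w * f w =
      ∑ w ∈ Finset.range (z.1 + 2) ×ˢ Finset.univ, sys.step lam hlam z w * f w := by
  refine tsum_eq_sum fun w hw => ?_
  rw [sys.step_eq_zero hlam, zero_mul]
  simp only [Finset.mem_product, Finset.mem_range, Finset.mem_univ, and_true, not_lt] at hw
  omega

/-- The mean of `n + h φ` after a step from a positive level: the level contributes the drift
`(A₁ - A₋₁) 1`, and the phase moves according to `S̃ + F̃`. -/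
lemma tsum_step_mul_ofReal (n : ℕ) (φ : Phase M) {h : Phase M → ℝ} (h0 : ∀ ψ, 0 ≤ h ψ) :
    ∑' w, sys.step lam hlam (n + 1, φ) w * ENNReal.ofReal (w.1 + h w.2) =
      ENNReal.ofReal ((n + 1 : ℝ) + ((sys.Stilde + sys.Ftilde) *ᵥ h) φ +
        ((sys.Aup lam - sys.Adown lam) *ᵥ 1) φ) := by
  have hterm : ∀ w : State M, sys.step lam hlam (n + 1, φ) w * ENNReal.ofReal (w.1 + h w.2) =
      ENNReal.ofReal ((sys.step lam hlam (n + 1, φ) w).toReal * (w.1 + h w.2)) := by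
    intro w
    rw [ENNReal.ofReal_mul ENNReal.toReal_nonneg,
      ENNReal.ofReal_toReal ((sys.step lam hlam _).apply_ne_top w)]
  rw [tsum_step_mul, Finset.sum_congr rfl fun w _ => hterm w,
    ← ENNReal.ofReal_sum_of_nonneg fun w _ => mul_nonneg ENNReal.toReal_nonneg
      (add_nonneg (Nat.cast_nonneg _) (h0 _))]
  congr 1
  have hrow := sum_row_of_mem_rowStochastic sys.Stilde_add_Ftilde_mem_rowStochastic φ
  rw [Finset.sum_product, Finset.sum_range_succ, Finset.sum_range_succ, Finset.sum_range_succ,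
    Finset.sum_eq_zero fun m hm => Finset.sum_eq_zero fun ψ _ => ?_]
  · simp only [toReal_step]
    have e₁ : ∀ ψ, qbdMatrix ((1 - lam) • sys.Ntilde) (lam • sys.Ntilde)
        (sys.Adown lam) (sys.Asame lam) (sys.Aup lam) (n + 1, φ) (n, ψ) = sys.Adown lam φ ψ := by
      intro ψ; simp [qbdMatrix]
    have e₂ : ∀ ψ, qbdMatrix ((1 - lam) • sys.Ntilde) (lam • sys.Ntilde)
        (sys.Adown lam) (sys.Asame lam) (sys.Aup lam) (n + 1, φ) (n + 1, ψ) =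
          sys.Asame lam φ ψ := by
      intro ψ; simp [qbdMatrix]
    have e₃ : ∀ ψ, qbdMatrix ((1 - lam) • sys.Ntilde) (lam • sys.Ntilde)
        (sys.Adown lam) (sys.Asame lam) (sys.Aup lam) (n + 1, φ) (n + 1 + 1, ψ) =
          sys.Aup lam φ ψ := by
      intro ψ; simp [qbdMatrix]; omega
    simp only [e₁, e₂, e₃]
    have hn : (n + 1 : ℝ) = ∑ ψ, (sys.Stilde + sys.Ftilde) φ ψ * (n + 1) := by
      rw [← Finset.sum_mul, hrow, one_mul]
    rw [hn, zero_add]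
    simp only [mulVec, dotProduct, ← Finset.sum_add_distrib, ← sys.Adown_add_Asame_add_Aup lam]
    refine Finset.sum_congr rfl fun ψ _ => ?_
    simp only [Matrix.add_apply, Matrix.sub_apply, Pi.one_apply]
    push_cast
    ring
  · have hm := Finset.mem_range.1 hm
    rw [toReal_step]
    simp only [qbdMatrix, of_apply]
    rw [if_neg (by omega), if_neg (by omega), if_neg (by omega), if_neg (by omega), zero_mul]

/-- With `ε = μ* - λ > 0` and a nonnegative solution `h` of Poisson's equation for the drift, the
function `(n + h φ) / ε` decreases in the mean by exactly one per step in the levels `n ≥ 1`. -/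
theorem exists_isDriftCertificate [Nonempty (Phase M)] {π : Phase M → ℝ}
    (hπ : IsStationaryDistribution (sys.Stilde + sys.Ftilde) π)
    (huniq : ∀ π' : Phase M → ℝ,
      IsStationaryDistribution (sys.Stilde + sys.Ftilde) π' → π' = π)
    (hlt : lam < sys.muStar π) :
    ∃ W, IsDriftCertificate (sys.step lam hlam) {w | w.1 = 0} Set.univ W := by
  have hP := sys.Stilde_add_Ftilde_mem_rowStochastic
  obtain ⟨h', hh'⟩ := exists_poisson_solution hP hπ huniq ((sys.Aup lam - sys.Adown lam) *ᵥ 1)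
  set ε := sys.muStar π - lam with hε
  have hε0 : 0 < ε := sub_pos.2 hlt
  -- a constant is added to the solution, to keep the mean of `n + h φ` after a step nonnegative
  obtain ⟨h, hεh, hh⟩ : ∃ h : Phase M → ℝ, (∀ ψ, ε ≤ h ψ) ∧ ∀ φ,
      ((sys.Stilde + sys.Ftilde) *ᵥ h) φ + ((sys.Aup lam - sys.Adown lam) *ᵥ 1) φ = h φ - ε := by
    obtain ⟨ψ₀, hψ₀⟩ := Finite.exists_min h'
    refine ⟨h' - (h' ψ₀ - ε) • 1, fun ψ => ?_, fun φ => ?_⟩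
    · simp only [Pi.sub_apply, Pi.smul_apply, Pi.one_apply, smul_eq_mul, mul_one]
      linarith [hψ₀ ψ]
    have h1 := hh' φ
    rw [sys.dotProduct_Aup_sub_Adown lam hπ.1] at h1
    rw [mulVec_sub, mulVec_smul, hP.2]
    simp only [Pi.sub_apply, Pi.smul_apply, Pi.one_apply, smul_eq_mul]
    linarith
  have h0 : ∀ ψ, 0 ≤ h ψ := fun ψ => hε0.le.trans (hεh ψ)
  let V : State M → ℝ≥0∞ := fun w => ENNReal.ofReal ε⁻¹ * ENNReal.ofReal (w.1 + h w.2)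
  have hVtop : ∀ w, V w < ∞ := fun w =>
    ENNReal.mul_lt_top ENNReal.ofReal_lt_top ENNReal.ofReal_lt_top
  let B : Set (State M) := {w | w.1 = 0}
  -- in level 0 the certificate is the mean of `V` after one step, plus one
  let W : State M → ℝ≥0∞ := fun z =>
    if z.1 = 0 then 1 + ∑' w, sys.step lam hlam z w * Bᶜ.indicator V w else V z
  have hind : Bᶜ.indicator W = Bᶜ.indicator V := by
    refine Set.indicator_congr fun w hw => ?_
    have hw : w.1 ≠ 0 := hw
    simp [W, hw]
  refine ⟨W, fun z _ => ?_, fun z _ => ?_⟩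
  · by_cases hz : z.1 = 0
    · simp only [W, hz, if_true]
      rw [tsum_step_mul]
      refine ENNReal.add_lt_top.2 ⟨ENNReal.one_lt_top, ENNReal.sum_lt_top.2 fun w _ => ?_⟩
      refine ENNReal.mul_lt_top ((sys.step lam hlam z).apply_lt_top w) ?_
      exact (Set.indicator_le_self _ _ _).trans_lt (hVtop w)
    · simpa [W, hz] using hVtop z
  · change 1 + ∑' w, sys.step lam hlam z w * Bᶜ.indicator W w ≤ W z
    rw [hind]
    obtain ⟨_ | n, φ⟩ := z
    · simp [W]
    · calc 1 + ∑' w, sys.step lam hlam (n + 1, φ) w * Bᶜ.indicator V w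
          ≤ 1 + ∑' w, sys.step lam hlam (n + 1, φ) w * V w := by
            gcongr
            exact Set.indicator_le_self _ _ _
        _ = 1 + ENNReal.ofReal ε⁻¹ * ENNReal.ofReal ((n + 1 : ℝ) + h φ - ε) := by
            simp only [V, mul_left_comm _ (ENNReal.ofReal ε⁻¹)]
            rw [ENNReal.tsum_mul_left, sys.tsum_step_mul_ofReal hlam n φ h0, add_assoc, hh,
              ← add_sub_assoc]
        _ = W (n + 1, φ) := by
            have hnn : 0 ≤ (n + 1 : ℝ) + h φ - ε := by
              linarith [hεh φ, n.cast_nonneg (α := ℝ)]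
            simp only [W, V, Nat.add_eq_zero_iff, one_ne_zero, and_false, if_false]
            rw [← ENNReal.ofReal_mul (by positivity), ← ENNReal.ofReal_mul (by positivity),
              ← ENNReal.ofReal_one, ← ENNReal.ofReal_add zero_le_one (by positivity)]
            congr 1
            push_cast
            field_simp
            ring

end ControlledSystem

end Stability

theorem mainTheorem2 {M : ℕ} (hM : 1 ≤ M) (sys : ControlledSystem M) :
    -- the phase matrices are stochastic
    sys.Stilde + sys.Ftilde ∈ rowStochastic ℝ (Phase M) ∧
    sys.Ntilde ∈ rowStochastic ℝ (Phase M) ∧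
    -- `Z(t)` is a QBD with the stated blocks, and its phase process has the
    -- stationary distributions of `S̃ + F̃`, whatever the arrival rate
    (∀ (lam : ℝ) (hlam : lam ∈ Set.Icc (0 : ℝ) 1),
      (∀ z w : State M, (sys.step lam hlam z w).toReal =
        qbdMatrix ((1 - lam) • sys.Ntilde) (lam • sys.Ntilde)
          (sys.Adown lam) (sys.Asame lam) (sys.Aup lam) z w) ∧
      (∀ π : Phase M → ℝ,
        IsStationaryDistribution (sys.Adown lam + sys.Asame lam + sys.Aup lam) π ↔
          IsStationaryDistribution (sys.Stilde + sys.Ftilde) π)) ∧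
    -- existence of a stationary distribution, and uniqueness in the irreducible case
    (∃ π : Phase M → ℝ, IsStationaryDistribution (sys.Stilde + sys.Ftilde) π) ∧
    ((sys.Stilde + sys.Ftilde).IsIrreducible →
      ∃! π : Phase M → ℝ, IsStationaryDistribution (sys.Stilde + sys.Ftilde) π) ∧
    -- the stability criterion
    (∀ π : Phase M → ℝ, IsStationaryDistribution (sys.Stilde + sys.Ftilde) π →
      ∀ (lam : ℝ) (hlam : lam ∈ Set.Icc (0 : ℝ) 1),
        (π ⬝ᵥ ((sys.Aup lam - sys.Adown lam) *ᵥ 1) < 0 ↔ lam < sys.muStar π) ∧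
        ((∀ π' : Phase M → ℝ, IsStationaryDistribution (sys.Stilde + sys.Ftilde) π' → π' = π) →
          lam < sys.muStar π →
            (∀ z : State M, meanReturnTime (sys.step lam hlam) {w | w.1 = 0} z < ∞) ∧
            (∀ z : State M, IsEssential (sys.step lam hlam) z →
              IsPositiveRecurrent (sys.step lam hlam) z))) := by
  have : Nonempty (Fin M) := ⟨⟨0, hM⟩⟩
  have hP := sys.Stilde_add_Ftilde_mem_rowStochastic
  refine ⟨hP, sys.Ntilde_mem_rowStochastic, fun lam hlam => ⟨sys.toReal_step lam hlam, fun π => ?_⟩,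
    exists_isStationaryDistribution hP, existsUnique_isStationaryDistribution hP,
    fun π hπ lam hlam => ⟨?_, fun huniq hlt => ?_⟩⟩
  · rw [sys.Adown_add_Asame_add_Aup]
  · rw [sys.dotProduct_Aup_sub_Adown lam hπ.1, sub_neg]
  · obtain ⟨W, hW⟩ := sys.exists_isDriftCertificate hlam hπ huniq hlt
    have hfin : {w : State M | w.1 = 0}.Finite :=
      (Set.finite_univ.image fun φ : Phase M => ((0, φ) : State M)).subset
        fun w hw => ⟨w.2, trivial, Prod.ext (Eq.symm hw) rfl⟩
    exact ⟨fun z => hW.meanReturnTime_lt_top (fun _ _ _ _ => trivial) trivial,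
      fun z hz => isPositiveRecurrent_of_isEssential hfin hW hz⟩
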